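/- All graphs are finite, simple and undirected. $G$ is an induced subgraph of $H$, written $G \sqsubseteq H$, if there is an embedding of $G$ into $H$, that is, an injective map $h \colon V(G)\to V(H)$ such that $\{h(u),h(v)\}\in E(H)$ if and only if $\{u,v\}\in E(G)$. A class of graphs is hereditary if it is closed under induced subgraphs; the hereditary closure $\downarrow_{\sqsubseteq}\mathcal C$ of a class $\mathcal C$ is the class of all induced subgraphs of graphs in $\mathcal C$. A class $\mathcal C$ is $k$-well-quasi-ordered if for every set $X$ with at most $k$ elements and every sequence $(G_i,\ell_i)_{i\in\mathbb N}$ of graphs $G_i\in\mathcal C$ with labellings $\ell_i\colon V(G_i)\to X$ there are $i<j$ and an embedding $h$ of $G_i$ into $G_j$ with $\ell_j(h(v))=\ell_i(v)$ for all $v\in V(G_i)$. An MSO-interpretation $I$ from words over a finite alphabet $\Sigma$ to graphs consists of three formulas of monadic second-order logic over finite words on $\Sigma$: $\varphi_{\mathrm{edge}}(x,y)$, $\varphi_{\mathrm{dom}}(x)$ and a sentence $\varphi_\Delta$. For $w\in\Sigma^*$, the graph $I(w)$ has as vertices the positions $i$ of $w$ with $w\models\varphi_{\mathrm{dom}}(i)$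 and as edges the pairs $\{i,j\}$ of vertices with $i<j$ and $w\models\varphi_{\mathrm{edge}}(i,j)$. The image $\mathrm{Im}(I)$ is the class of all graphs isomorphic to $I(w)$ for some $w\in\Sigma^*$ with $w\models\varphi_\Delta$. A class $\mathcal C$ of graphs has bounded linear clique-width if there are a finite alphabet $\Sigma$ and an MSO-interpretation $I$ from words over $\Sigma$ to graphs such that $\mathcal C\subseteq\mathrm{Im}(I)$. **Lemma (Sandwich Lemma).** Let $\mathcal C$ be a hereditary class of graphs that has bounded linear clique-width and is $2$-well-quasi-ordered. Then there exist a finite alphabet $\Sigma$ and an MSO-interpretation $I$ from words over $\Sigma$ to graphs such that $$\mathcal C\subseteq \mathrm{Im}(I)\subseteq \;\downarrow_{\sqsubseteq}\mathcal C .$$ -/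

import Mathlib

universe u

/-! ### Finite graphs and classes of graphs -/

/-- A finite, simple, undirected graph. A class of graphs is a `Set FinGraph`. -/
structure FinGraph where
  V : Type u
  [finite : Finite V]
  graph : SimpleGraph V

namespace FinGraph

/-- `G` is an induced subgraph of `H`: there is an injective map of the vertices that preserves
and reflects the edge relation. -/
def IsInducedSubgraph (G H : FinGraph.{u}) : Prop :=
  Nonempty (G.graph ↪g H.graph)

end FinGraph

/-- A class of graphs is hereditary if it is closed under taking induced subgraphs. -/
def IsHereditary (C : Set FinGraph.{u}) : Prop :=
  ∀ G H : FinGraph.{u}, H ∈ C → G.IsInducedSubgraph H → G ∈ C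

/-- The hereditary closure of a class: all induced subgraphs of its members. -/
def hereditaryClosure (C : Set FinGraph.{u}) : Set FinGraph.{u} :=
  {G | ∃ H ∈ C, G.IsInducedSubgraph H}

/-- The class of `X`-labelled graphs of `C`. -/
structure LabelledGraph (X : Type) (C : Set FinGraph.{u}) where
  toGraph : FinGraph.{u}
  mem : toGraph ∈ C
  label : toGraph.V → X

/-- Existence of an embedding of `X`-labelled graphs, where `X` is ordered by equality. -/
def LabelledGraph.Embeds {X : Type} {C : Set FinGraph.{u}} (G H : LabelledGraph X C) : Prop :=
  ∃ h : G.toGraph.graph ↪g H.toGraph.graph, ∀ v, H.label (h v) = G.label v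

/-- `C` is `k`-well-quasi-ordered: for every set `X` with at most `k` elements (ordered by
equality), the `X`-labelled graphs of `C` are well-quasi-ordered by labelled embedding. -/
def IsKWellQuasiOrdered (k : ℕ) (C : Set FinGraph.{u}) : Prop :=
  ∀ X : Type, Finite X → Nat.card X ≤ k →
    WellQuasiOrdered (LabelledGraph.Embeds (X := X) (C := C))

/-! ### Monadic second-order logic over finite words -/

/-- Formulas of monadic second-order logic over words on the alphabet `A`, with free first-order
variables indexed by `Fin n` and free set variables indexed by `Fin m`. A quantifier binds the
variable `0` of its body and shifts the others by one. -/
inductive MSO (A : Type) : ℕ → ℕ → Type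
  | falsum {n m : ℕ} : MSO A n m
  | eq {n m : ℕ} (x y : Fin n) : MSO A n m
  | lt {n m : ℕ} (x y : Fin n) : MSO A n m
  | letter {n m : ℕ} (a : A) (x : Fin n) : MSO A n m
  | mem {n m : ℕ} (x : Fin n) (S : Fin m) : MSO A n m
  | neg {n m : ℕ} (φ : MSO A n m) : MSO A n m
  | and {n m : ℕ} (φ ψ : MSO A n m) : MSO A n m
  | existsPos {n m : ℕ} (φ : MSO A (n + 1) m) : MSO A n m
  | existsSet {n m : ℕ} (φ : MSO A n (m + 1)) : MSO A n m

/-- Satisfaction of a formula in a word `w`: first-order variables range over the positions of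
`w`, set variables over the sets of positions of `w`. -/
def MSO.Sat {A : Type} (w : List A) : {n m : ℕ} → MSO A n m →
    (Fin n → Fin w.length) → (Fin m → Set (Fin w.length)) → Prop
  | _, _, .falsum, _, _ => False
  | _, _, .eq x y, p, _ => p x = p y
  | _, _, .lt x y, p, _ => p x < p y
  | _, _, .letter a x, p, _ => w.get (p x) = a
  | _, _, .mem x S, p, s => p x ∈ s S
  | _, _, .neg φ, p, s => ¬ φ.Sat w p s
  | _, _, .and φ ψ, p, s => φ.Sat w p s ∧ ψ.Sat w p s
  | _, _, .existsPos φ, p, s => ∃ i : Fin w.length, φ.Sat w (Fin.cons i p) s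
  | _, _, .existsSet φ, p, s => ∃ S : Set (Fin w.length), φ.Sat w p (Fin.cons S s)

/-! ### Interpretations of graphs in words -/

/-- A (simple) MSO-interpretation from words over `A` to finite graphs: an edge formula with two
free first-order variables, a domain formula with one, and a selection sentence. -/
structure MSOInterpretation (A : Type) where
  edge : MSO A 2 0
  dom : MSO A 1 0
  select : MSO A 0 0

namespace MSOInterpretation

variable {A : Type}

/-- `w ⊨ φ_edge(i, j)`. -/
def EdgeHolds (I : MSOInterpretation A) (w : List A) (i j : Fin w.length) : Prop :=
  I.edge.Sat w ![i, j] ![]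

/-- `w ⊨ φ_dom(i)`. -/
def DomHolds (I : MSOInterpretation A) (w : List A) (i : Fin w.length) : Prop :=
  I.dom.Sat w ![i] ![]

/-- `w ⊨ φ_Δ`. -/
def Selects (I : MSOInterpretation A) (w : List A) : Prop :=
  I.select.Sat w ![] ![]

/-- The graph `I(w)`: its vertices are the positions of `w` that satisfy the domain formula, and
`{i, j}` is an edge, for `i < j`, if `w` satisfies the edge formula at `(i, j)`. -/
def eval (I : MSOInterpretation A) (w : List A) :
    SimpleGraph {i : Fin w.length // I.DomHolds w i} where
  Adj i j := (i.1 < j.1 ∧ I.EdgeHolds w i.1 j.1) ∨ (j.1 < i.1 ∧ I.EdgeHolds w j.1 i.1)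
  symm := ⟨fun _ _ h => h.symm⟩
  loopless := ⟨fun _ h => h.elim (fun h => lt_irrefl _ h.1) (fun h => lt_irrefl _ h.1)⟩

/-- The image of `I`: the graphs `I(w)`, up to isomorphism, for the words `w` that satisfy the
selection formula. -/
def image (I : MSOInterpretation A) : Set FinGraph.{u} :=
  {G | ∃ w : List A, I.Selects w ∧ Nonempty (I.eval w ≃g G.graph)}

end MSOInterpretation

/-- A class of graphs has bounded linear clique-width if it is included in the image of an
MSO-interpretation from the words over some finite alphabet. -/
def HasBoundedLinearCliqueWidth (C : Set FinGraph.{u}) : Prop :=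
  ∃ (A : Type) (_ : Finite A) (I : MSOInterpretation A), C ⊆ I.image

/-! A hereditary class is determined by its minimal obstructions, and 2-well-quasi-ordering bounds
their size. Delete one vertex from each obstruction and label the rest by adjacency to it: these are
2-labelled graphs of `C`, and a labelled embedding between two of them extends to the obstructions
themselves. Among obstructions of strictly increasing size this contradicts minimality
(`bddAbove_card_isMinimalObstruction`). Containing a fixed finite graph is MSO-definable in the word
(`sat_containsFormula`), so adding the finitely many exclusions to the selection sentence cuts the
image down to `C` exactly. -/

/-! ### Minimal obstructions of a hereditary class -/

namespace FinGraph

/-- The subgraph induced by deleting the vertex `v`. -/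
def deleteVertex (G : FinGraph.{u}) (v : G.V) : FinGraph.{u} :=
  haveI := G.finite
  ⟨{x : G.V // x ≠ v}, G.graph.comap Subtype.val⟩

/-- The induced embedding of a vertex-deleted subgraph. -/
def deleteVertexEmbedding (G : FinGraph.{u}) (v : G.V) :
    (G.deleteVertex v).graph ↪g G.graph :=
  ⟨Function.Embedding.subtype _, Iff.rfl⟩

theorem card_deleteVertex_lt (G : FinGraph.{u}) (v : G.V) :
    Nat.card (G.deleteVertex v).V < Nat.card G.V := by
  have := G.finite
  exact Finite.card_subtype_lt (p := fun x => x ≠ v) (x := v) (by simp)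

/-- The copy of a graph on `Fin n` in an arbitrary universe. -/
def ofFin {n : ℕ} (H : SimpleGraph (Fin n)) : FinGraph.{u} :=
  ⟨ULift (Fin n), H.comap ULift.down⟩

/-- The canonical isomorphism from `ofFin H` to `H`. -/
def ofFinIso {n : ℕ} (H : SimpleGraph (Fin n)) : (ofFin.{u} H).graph ≃g H :=
  ⟨Equiv.ulift, Iff.rfl⟩

/-- `G` is a minimal obstruction of `C`: it is not in `C`, but all its vertex-deleted subgraphs
are. -/
def IsMinimalObstruction (C : Set FinGraph.{u}) (G : FinGraph.{u}) : Prop :=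
  G ∉ C ∧ ∀ v, G.deleteVertex v ∈ C

/-- Vertices are deleted as long as the result stays outside `C`; finiteness stops the process. -/
theorem exists_isMinimalObstruction {C : Set FinGraph.{u}} {G : FinGraph.{u}} (hG : G ∉ C) :
    ∃ H, IsMinimalObstruction C H ∧ H.IsInducedSubgraph G := by
  induction hn : Nat.card G.V using Nat.strong_induction_on generalizing G with
  | _ n ih =>
    by_cases h : ∀ v, G.deleteVertex v ∈ C
    · exact ⟨G, ⟨hG, h⟩, ⟨SimpleGraph.Embedding.refl⟩⟩
    · push Not at h
      obtain ⟨v, hv⟩ := h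
      obtain ⟨H, hH, ⟨e⟩⟩ := ih _ (hn ▸ G.card_deleteVertex_lt v) hv rfl
      exact ⟨H, hH, ⟨(G.deleteVertexEmbedding v).comp e⟩⟩

/-- An embedding of vertex-deleted subgraphs that respects adjacency to the deleted vertices
extends to the whole graphs. -/
theorem isInducedSubgraph_of_deleteVertex {G H : FinGraph.{u}} {v : G.V} {w : H.V}
    (h : (G.deleteVertex v).graph ↪g (H.deleteVertex w).graph)
    (hadj : ∀ x, H.graph.Adj w (h x).1 ↔ G.graph.Adj v x.1) : G.IsInducedSubgraph H := by
  classical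
  let f : G.V → H.V := fun x => if hx : x = v then w else (h ⟨x, hx⟩).1
  have fv : f v = w := by simp [f]
  have fne : ∀ x (hx : x ≠ v), f x = (h ⟨x, hx⟩).1 := fun x hx => by simp [f, hx]
  refine ⟨⟨⟨f, fun x y hxy => ?_⟩, fun {x y} => ?_⟩⟩
  · by_cases hx : x = v <;> by_cases hy : y = v
    · rw [hx, hy]
    · subst hx
      rw [fv, fne y hy] at hxy
      exact absurd hxy.symm (h ⟨y, hy⟩).2
    · subst hy
      rw [fv, fne x hx] at hxy
      exact absurd hxy (h ⟨x, hx⟩).2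
    · rw [fne x hx, fne y hy] at hxy
      exact congrArg Subtype.val (h.injective (Subtype.ext hxy))
  · change H.graph.Adj (f x) (f y) ↔ G.graph.Adj x y
    by_cases hx : x = v <;> by_cases hy : y = v
    · simp [hx, hy]
    · subst hx
      rw [fv, fne y hy]
      exact hadj ⟨y, hy⟩
    · subst hy
      rw [fv, fne x hx, SimpleGraph.adj_comm, G.graph.adj_comm]
      exact hadj ⟨x, hx⟩
    · rw [fne x hx, fne y hy]
      exact h.map_rel_iff (a := ⟨x, hx⟩) (b := ⟨y, hy⟩)

/-- Minimal obstructions of a hereditary class cannot properly contain one another. -/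
theorem IsMinimalObstruction.card_le_of_isInducedSubgraph {C : Set FinGraph.{u}}
    (hereditary : IsHereditary C) {G H : FinGraph.{u}} (hG : IsMinimalObstruction C G)
    (hH : IsMinimalObstruction C H) (h : G.IsInducedSubgraph H) :
    Nat.card H.V ≤ Nat.card G.V := by
  obtain ⟨e⟩ := h
  have := G.finite
  refine Nat.card_le_card_of_surjective e fun w => ?_
  by_contra hw
  push Not at hw
  -- If `e` missed `w`, then `G` would embed in `H` minus `w`, which lies in `C`.
  exact hG.1 (hereditary _ _ (hH.2 w)
    ⟨⟨fun x => ⟨e x, hw x⟩, fun x y hxy => e.injective (congrArg Subtype.val hxy)⟩,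
      e.map_rel_iff⟩)

/-- A hereditary 2-well-quasi-ordered class has minimal obstructions of bounded size only. -/
theorem bddAbove_card_isMinimalObstruction {C : Set FinGraph.{u}} (hereditary : IsHereditary C)
    (wqo : IsKWellQuasiOrdered 2 C) :
    BddAbove {n | ∃ G, IsMinimalObstruction C G ∧ Nat.card G.V = n} := by
  by_contra hS
  have hinf := Set.infinite_of_not_bddAbove hS
  obtain ⟨f, hmono, hf⟩ : ∃ f : ℕ → ℕ, StrictMono f ∧
      ∀ k, ∃ G, IsMinimalObstruction C G ∧ Nat.card G.V = f k :=
    ⟨_, Nat.nth_strictMono hinf, Nat.nth_mem_of_infinite hinf⟩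
  -- The shift by one makes every size positive, so that there is a vertex to delete.
  choose G hG hcard using fun k => hf (k + 1)
  have hne : ∀ k, Nonempty (G k).V := fun k => by
    have h : f k < f (k + 1) := hmono k.lt_succ_self
    exact (Nat.card_pos_iff.1 (by rw [hcard]; omega)).1
  let v : ∀ k, (G k).V := fun k => Classical.choice (hne k)
  -- `Prop` is the two-element label set; the label of `x` is its adjacency to the deleted vertex.
  obtain ⟨i, j, hij, h, hl⟩ := wqo Prop inferInstance (by simp)
    fun k => ⟨(G k).deleteVertex (v k), (hG k).2 _, fun x => (G k).graph.Adj (v k) x.1⟩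
  have hle := (hG i).card_le_of_isInducedSubgraph hereditary (hG j)
    (isInducedSubgraph_of_deleteVertex h fun x => iff_of_eq (hl x))
  rw [hcard, hcard] at hle
  exact absurd (hmono (Nat.succ_lt_succ hij)) (not_lt.2 hle)

end FinGraph

/-! ### Renaming of first-order variables and existential closure -/

namespace MSO

variable {A : Type}

/-- Renaming of the free first-order variables. -/
def rename : {n m : ℕ} → MSO A n m → {k : ℕ} → (Fin n → Fin k) → MSO A k m
  | _, _, .falsum, _, _ => .falsum
  | _, _, .eq x y, _, f => .eq (f x) (f y)
  | _, _, .lt x y, _, f => .lt (f x) (f y)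
  | _, _, .letter a x, _, f => .letter a (f x)
  | _, _, .mem x S, _, f => .mem (f x) S
  | _, _, .neg φ, _, f => .neg (φ.rename f)
  | _, _, .and φ ψ, _, f => .and (φ.rename f) (ψ.rename f)
  | _, _, .existsPos φ, _, f => .existsPos (φ.rename (Fin.cons 0 (Fin.succ ∘ f)))
  | _, _, .existsSet φ, _, f => .existsSet (φ.rename f)

theorem sat_rename (w : List A) {n m : ℕ} (φ : MSO A n m) {k : ℕ} (f : Fin n → Fin k)
    (p : Fin k → Fin w.length) (s : Fin m → Set (Fin w.length)) :
    (φ.rename f).Sat w p s ↔ φ.Sat w (p ∘ f) s := by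
  induction φ generalizing k with
  | falsum => rfl
  | eq x y => rfl
  | lt x y => rfl
  | letter a x => rfl
  | mem x S => rfl
  | neg φ ih => simp only [rename, Sat, ih]
  | and φ ψ ih₁ ih₂ => simp only [rename, Sat, ih₁, ih₂]
  | existsPos φ ih =>
    simp only [rename, Sat, ih]
    refine exists_congr fun i => ?_
    have : (Fin.cons i p : Fin (k + 1) → Fin w.length) ∘ (Fin.cons 0 (Fin.succ ∘ f)) =
        Fin.cons i (p ∘ f) := by
      funext x
      cases x using Fin.cases <;> simp
    rw [this]
  | existsSet φ ih => simp only [rename, Sat, ih]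

/-- Existential closure of the free first-order variables. -/
def existsAll : {n : ℕ} → MSO A n 0 → MSO A 0 0
  | 0, φ => φ
  | _ + 1, φ => existsAll (.existsPos φ)

theorem sat_existsAll (w : List A) {n : ℕ} (φ : MSO A n 0) :
    φ.existsAll.Sat w ![] ![] ↔ ∃ p : Fin n → Fin w.length, φ.Sat w p ![] := by
  induction n with
  | zero =>
    exact ⟨fun h => ⟨_, h⟩, fun ⟨p, h⟩ => by rwa [Subsingleton.elim p ![]] at h⟩
  | succ n ih =>
    rw [existsAll, ih]
    exact ⟨fun ⟨p, i, h⟩ => ⟨_, h⟩,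
      fun ⟨p, h⟩ => ⟨Fin.tail p, p 0, by rwa [Fin.cons_self_tail]⟩⟩

/-- The conjunction of a list of formulas. -/
def conj {n m : ℕ} (l : List (MSO A n m)) : MSO A n m :=
  l.foldr .and (.neg .falsum)

theorem sat_conj (w : List A) {n m : ℕ} (l : List (MSO A n m))
    (p : Fin n → Fin w.length) (s : Fin m → Set (Fin w.length)) :
    (conj l).Sat w p s ↔ ∀ φ ∈ l, φ.Sat w p s := by
  induction l with
  | nil => simp [conj, Sat]
  | cons φ l ih =>
    rw [List.forall_mem_cons, ← ih]
    rfl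

/-- The conjunction of a finite family of formulas. -/
noncomputable def conjAll {ι : Type} [Finite ι] {n m : ℕ} (φ : ι → MSO A n m) : MSO A n m :=
  haveI := Fintype.ofFinite ι
  conj (Finset.univ.toList.map φ)

theorem sat_conjAll (w : List A) {ι : Type} [Finite ι] {n m : ℕ} (φ : ι → MSO A n m)
    (p : Fin n → Fin w.length) (s : Fin m → Set (Fin w.length)) :
    (conjAll φ).Sat w p s ↔ ∀ i, (φ i).Sat w p s := by
  simp [conjAll, sat_conj]

end MSO

/-! ### Definability of induced subgraphs -/

namespace MSOInterpretation

variable {A : Type} (I : MSOInterpretation A)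

/-- Adjacency of the positions `x` and `y` in `I(w)`. -/
def adjFormula {n : ℕ} (x y : Fin n) : MSO A n 0 :=
  -- A disjunction by De Morgan; the order guards are needed because `eval` reads the edge formula
  -- on increasing pairs only.
  .neg (.and (.neg (.and (.lt x y) (I.edge.rename ![x, y])))
    (.neg (.and (.lt y x) (I.edge.rename ![y, x]))))

theorem sat_adjFormula (w : List A) {n : ℕ} (x y : Fin n) (p : Fin n → Fin w.length) :
    (I.adjFormula x y).Sat w p ![] ↔
      (p x < p y ∧ I.EdgeHolds w (p x) (p y)) ∨ (p y < p x ∧ I.EdgeHolds w (p y) (p x)) := by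
  have h : ∀ a b : Fin n, p ∘ ![a, b] = ![p a, p b] := fun a b => by
    funext i
    fin_cases i <;> rfl
  simp only [adjFormula, MSO.Sat, MSO.sat_rename, h, EdgeHolds]
  tauto

open Classical in
/-- The variables `x` and `y` are related in the same way as the vertices `x` and `y` of `H`. -/
noncomputable def pairFormula {n : ℕ} (H : SimpleGraph (Fin n)) (x y : Fin n) : MSO A n 0 :=
  .and (if x = y then .eq x y else .neg (.eq x y))
    (if H.Adj x y then I.adjFormula x y else .neg (I.adjFormula x y))

/-- The sentence that holds in `w` if and only if `H` is an induced subgraph of `I(w)`. -/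
noncomputable def containsFormula {n : ℕ} (H : SimpleGraph (Fin n)) : MSO A 0 0 :=
  MSO.existsAll (.and (MSO.conjAll fun x => I.dom.rename ![x])
    (MSO.conjAll fun q : Fin n × Fin n => I.pairFormula H q.1 q.2))

theorem sat_pairFormula (w : List A) {n : ℕ} (H : SimpleGraph (Fin n)) (x y : Fin n)
    (p : Fin n → Fin w.length) :
    (I.pairFormula H x y).Sat w p ![] ↔ (p x = p y ↔ x = y) ∧
      (((p x < p y ∧ I.EdgeHolds w (p x) (p y)) ∨ (p y < p x ∧ I.EdgeHolds w (p y) (p x))) ↔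
        H.Adj x y) := by
  rw [← sat_adjFormula]
  by_cases h : x = y <;> by_cases h' : H.Adj x y <;> simp [pairFormula, h, h', MSO.Sat]

/-- The satisfying tuples are the embeddings: the domain conjuncts make the values vertices, the
equality clauses make them distinct, and the adjacency clauses preserve and reflect edges. -/
theorem sat_containsFormula (w : List A) {n : ℕ} (H : SimpleGraph (Fin n)) :
    (I.containsFormula H).Sat w ![] ![] ↔ Nonempty (H ↪g I.eval w) := by
  have hd : ∀ (p : Fin n → Fin w.length) (x : Fin n), p ∘ ![x] = ![p x] := fun p x => by
    funext i
    fin_cases i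
    rfl
  simp only [containsFormula, MSO.sat_existsAll, MSO.Sat, MSO.sat_conjAll, MSO.sat_rename, hd,
    sat_pairFormula]
  constructor
  · rintro ⟨p, hdom, hp⟩
    exact ⟨⟨⟨fun x => ⟨p x, hdom x⟩, fun x y hxy =>
      (hp (x, y)).1.1 (congrArg Subtype.val hxy)⟩, fun {x y} => (hp (x, y)).2⟩⟩
  · rintro ⟨e⟩
    exact ⟨fun x => (e x).1, fun x => (e x).2, fun q =>
      ⟨⟨fun h => e.injective (Subtype.ext h), fun h => by rw [h]⟩, e.map_rel_iff⟩⟩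

/-- The interpretation `I` restricted to the words `w` such that `I(w)` contains no graph outside
of `C` with at most `N` vertices. -/
noncomputable def restrict (C : Set FinGraph.{u}) (N : ℕ) : MSOInterpretation A where
  edge := I.edge
  dom := I.dom
  -- There are finitely many graphs on `Fin n` with `n ≤ N`, so this is a single sentence.
  -- Non-minimal graphs outside `C` may be excluded too, as a hereditary `C` contains none of them.
  select := .and I.select (MSO.conjAll
    fun H : {H : Σ n : Fin (N + 1), SimpleGraph (Fin n) // FinGraph.ofFin.{u} H.2 ∉ C} =>
      .neg (I.containsFormula H.1.2))

theorem selects_restrict (C : Set FinGraph.{u}) (N : ℕ) (w : List A) :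
    (I.restrict C N).Selects w ↔ I.Selects w ∧
      ∀ n ≤ N, ∀ H : SimpleGraph (Fin n), FinGraph.ofFin.{u} H ∉ C →
        IsEmpty (H ↪g I.eval w) := by
  simp only [Selects, restrict, MSO.Sat, MSO.sat_conjAll, sat_containsFormula, not_nonempty_iff]
  exact and_congr_right fun _ =>
    ⟨fun h n hn H hH => h ⟨⟨⟨n, Nat.lt_succ_of_le hn⟩, H⟩, hH⟩,
      fun h H => h _ (Nat.le_of_lt_succ H.1.1.2) H.1.2 H.2⟩

end MSOInterpretation

theorem mainTheorem9 (C : Set FinGraph.{u}) (hereditary : IsHereditary C)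
    (boundedLCW : HasBoundedLinearCliqueWidth C) (wqo : IsKWellQuasiOrdered 2 C) :
    ∃ (A : Type) (_ : Finite A) (I : MSOInterpretation A),
      C ⊆ I.image ∧ I.image ⊆ hereditaryClosure C := by
  obtain ⟨A, hA, I, hI⟩ := boundedLCW
  obtain ⟨N, hN⟩ := FinGraph.bddAbove_card_isMinimalObstruction hereditary wqo
  refine ⟨A, hA, I.restrict C N, fun G hG => ?_, ?_⟩
  · obtain ⟨w, hw, ⟨e⟩⟩ := hI hG
    refine ⟨w, (I.selects_restrict C N w).2 ⟨hw, fun n _ H hH => ⟨fun f => ?_⟩⟩, ⟨e⟩⟩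
    exact hH (hereditary _ _ hG
      ⟨e.toEmbedding.comp (f.comp (FinGraph.ofFinIso H).toEmbedding)⟩)
  · rintro G ⟨w, hw, ⟨e⟩⟩
    -- The image lies in `C` itself, so `G` is its own witness.
    refine ⟨G, ?_, ⟨SimpleGraph.Embedding.refl⟩⟩
    by_contra hG
    obtain ⟨H, hH, ⟨f⟩⟩ := FinGraph.exists_isMinimalObstruction hG
    have := H.finite
    -- The obstruction is copied onto `Fin (Nat.card H.V)`, where the selection sentence excludes
    -- it.
    let c := Finite.equivFin H.V
    let K : SimpleGraph (Fin (Nat.card H.V)) := H.graph.comap c.symm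
    let i : K ≃g H.graph := SimpleGraph.Iso.comap c.symm H.graph
    refine (((I.selects_restrict C N w).1 hw).2 _ (hN ⟨H, hH, rfl⟩) K fun hK => ?_).false
      (e.symm.toEmbedding.comp (f.comp i.toEmbedding))
    exact hH.1 (hereditary _ _ hK ⟨(FinGraph.ofFinIso K).symm.toEmbedding.comp i.symm.toEmbedding⟩)
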